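/- Let $n\ge 0$ and $\mathcal N_n=\{1,\dots,n\}$. A conditional mutual independency (CMI) $K=(C,\langle Q_1,\dots,Q_k\rangle)$ on $X_1,\dots,X_n$ consists of a set $C\subseteq\mathcal N_n$ and an unordered collection (repetitions allowed, $k\ge 0$) of sets $Q_i\subseteq\mathcal N_n$, which may overlap each other or $C$. For discrete random variables $X_1,\dots,X_n$ with a given joint distribution, $K$ is valid if $X_{Q_1},\dots,X_{Q_k}$ are mutually independent conditioning on $X_C$, i.e. for all values $x_1,\dots,x_k,y$ of $X_{Q_1},\dots,X_{Q_k},X_C$, $p(x_1,\dots,x_k,y)=p(x_1|y)\cdots p(x_k|y)\,p(y)$ if $p(y)>0$, and $p(x_1,\dots,x_k,y)=0$ otherwise (here $X_A=(X_i)_{i\in A}$ and $X_\emptyset$ is constant). $K$ implies $K'$ if $K'$ is valid for every joint distribution of discrete $X_1,\dots,X_n$ with finite Shannon entropies $H(X_i)<\infty$ for which $K$ is valid. Write $(\cdot,\langle\ \rangle)$ for the degenerate CMI (empty collection; conditioning set immaterial), and let $\mathrm{pur}(K)=(C,\langle Q_i\setminus C: Q_i\setminus C\ne\emptyset\rangle)$.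 For $K=(C,\langle Q_1,\dots,Q_k\rangle)$ with all $Q_i$ nonempty and disjoint from $C$, let $\mathbb I$ be the set of indices that lie in $Q_i$ for at least two values of $i$, let $P_1,\dots,P_t$ be the nonempty sets among the $Q_i\setminus\mathbb I$, and let $$\mathrm{can}(K)=\begin{cases}(\cdot,\langle\ \rangle)&k\le 1,\\ (C,\langle P_1,\dots,P_t\rangle)&k\ge2,\ \mathbb I=\emptyset,\\ (C,\langle\mathbb I,\mathbb I\rangle)&k\ge2,\ \mathbb I\neq\emptyset,\ t\le1,\\ (C,\langle\mathbb I,\mathbb I,P_1,\dots,P_t\rangle)&k\ge2,\ \mathbb I\ne\emptyset,\ t\ge2.\end{cases}$$ Every $\mathrm{can}(\mathrm{pur}(K))$ is thus written uniquely as $(C,\langle\mathbb I_K,\mathbb I_K,P_1,\dots,P_t\rangle)$ with $t\ne1$, where $C$, $\mathbb I_K$ and the nonempty sets $P_i$ are pairwise disjoint, the two copies of $\mathbb I_K$ are omitted if $\mathbb I_K=\emptyset$, and $C=\mathbb I_K=\emptyset$, $t=0$ in the degenerate case. Given CMIs $K,K'$, write in this way $\mathrm{can}(\mathrm{pur}(K))=(C,\langle\mathbb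 I_K,\mathbb I_K,P_1,\dots,P_t\rangle)$ and $\mathrm{can}(\mathrm{pur}(K'))=(C',\langle\mathbb I_{K'},\mathbb I_{K'},P'_1,\dots,P'_s\rangle)$. Let $D=\mathbb I_{K'}\setminus\mathbb I_K$, let $T_1,\dots,T_u$ be the nonempty sets among the $P'_j\setminus\mathbb I_K$, and let $$K''=R_K^{K'}=\begin{cases}(\cdot,\langle\ \rangle)&D=\emptyset,\ u\le1,\\ (C'\setminus\mathbb I_K,\langle T_1,\dots,T_u\rangle)&D=\emptyset,\ u\ge2,\\ (C'\setminus\mathbb I_K,\langle D,D\rangle)&D\neq\emptyset,\ u\le1,\\ (C'\setminus\mathbb I_K,\langle D,D,T_1,\dots,T_u\rangle)&D\ne\emptyset,\ u\ge2.\end{cases}$$ Write $\mathrm{can}(\mathrm{pur}(K''))=(C'',\langle\mathbb I_{K''},\mathbb I_{K''},P''_1,\dots,P''_r\rangle)$, $P=\bigcup_iP_i$, $S=C\cup P$, $P''=\bigcup_jP''_j$. Then $K'$ is called a sub-CMI of $K$ if one of the following holds: (i) $K'$ is degenerate, i.e. $\mathrm{can}(\mathrm{pur}(K'))=(\cdot,\langle\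 \rangle)$; (ii) $\mathrm{can}(\mathrm{pur}(K''))=(\cdot,\langle\ \rangle)$ and $C\subseteq C'$; (iii) $\mathrm{can}(\mathrm{pur}(K''))\ne(\cdot,\langle\ \rangle)$; $\mathbb I_{K''}=\emptyset$; $P''\subseteq P$; $C\subseteq C''\subseteq S\setminus P''$; and whenever $m_1\in P''_{j_1}$, $m_2\in P''_{j_2}$ with $j_1\ne j_2$, we have $m_1\in P_{i_1}$ and $m_2\in P_{i_2}$ for some $i_1\ne i_2$. **Theorem.** For any two CMIs $K$ and $K'$ on $X_1,\dots,X_n$, $K$ implies $K'$ if and only if $K'$ is a sub-CMI of $K$. The same holds if, in the definition of "implies", all joint distributions of discrete random variables are considered, without the requirement of finite entropies. -/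

import Mathlib

/-- A conditional mutual independency (CMI) `K = (C, ⟨Q_1, …, Q_k⟩)` on `X_1, …, X_n`: a
conditioning set `cond = C` of indices and an unordered collection `parts = ⟨Q_1, …, Q_k⟩`, `k ≥ 0`,
of sets of indices, in which sets may repeat, overlap each other, overlap `C`, or be empty. -/
@[ext] structure CMI (n : ℕ) where
  cond : Finset (Fin n)
  parts : Multiset (Finset (Fin n))

namespace CMI

section Probability

variable {n : ℕ} {α : Fin n → Type}

/-- The event `X_A = x_A`, for a set `A` of indices. Only the coordinates of `x` in `A` matter, and
for `A = ∅` this is the sure event. -/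
def agree (A : Finset (Fin n)) (x : ∀ i, α i) : Set (∀ i, α i) :=
  {ω | ∀ i ∈ A, ω i = x i}

/-- The probability of an event under the joint distribution `p` of `X_1, …, X_n`. -/
noncomputable def prob (p : PMF (∀ i, α i)) (E : Set (∀ i, α i)) : ℝ :=
  (p.toOuterMeasure E).toReal

/-- `K` is valid for the joint distribution `p`: `X_{Q_1}, …, X_{Q_k}` are mutually independent
conditioning on `X_C`, that is, for all values `x_1, …, x_k, y` of `X_{Q_1}, …, X_{Q_k}, X_C`,
`p(x_1, …, x_k, y)` is `p(x_1 | y) ⋯ p(x_k | y) p(y)` if `p(y) > 0` and `0` otherwise.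
The values `x_j`, `y` are chosen independently of each other, so they need not be consistent on
indices that are common to several of the groups. -/
noncomputable def IsValid (K : CMI n) (p : PMF (∀ i, α i)) : Prop :=
  ∀ (x : K.parts → ∀ i, α i) (y : ∀ i, α i),
    prob p ({ω | ∀ j : K.parts, ω ∈ agree (j : Finset (Fin n)) (x j)} ∩ agree K.cond y) =
      if 0 < prob p (agree K.cond y) then
        (∏ j : K.parts, prob p (agree (j : Finset (Fin n)) (x j) ∩ agree K.cond y) /
          prob p (agree K.cond y)) * prob p (agree K.cond y)
      else 0

/-- Every `X_i` has finite Shannon entropy `H(X_i) = ∑ₓ - p(x) log p(x)`. -/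
noncomputable def FiniteEntropy (p : PMF (∀ i, α i)) : Prop :=
  ∀ i, Summable fun a : α i => Real.negMulLog ((p.map fun ω => ω i) a).toReal

end Probability

variable {n : ℕ}

/-- `K` implies `K'`, over the joint distributions of discrete random variables `X_1, …, X_n`
with finite entropies. -/
noncomputable def Implies (K K' : CMI n) : Prop :=
  ∀ (α : Fin n → Type) [∀ i, Countable (α i)] (p : PMF (∀ i, α i)),
    FiniteEntropy p → K.IsValid p → K'.IsValid p

/-- `K` implies `K'`, over all joint distributions of discrete random variables `X_1, …, X_n`. -/
noncomputable def ImpliesDiscrete (K K' : CMI n) : Prop :=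
  ∀ (α : Fin n → Type) [∀ i, Countable (α i)] (p : PMF (∀ i, α i)),
    K.IsValid p → K'.IsValid p

/-- The nonempty sets among `Q_i \ A`, for `Q_i` in the collection `s`. -/
def removeFrom (A : Finset (Fin n)) (s : Multiset (Finset (Fin n))) :
    Multiset (Finset (Fin n)) :=
  (s.map (· \ A)).filter (· ≠ ∅)

/-- The degenerate CMI `(·, ⟨ ⟩)`, which imposes no constraint. Its conditioning set is immaterial
and is normalized to `∅`. -/
def triv : CMI n := ⟨∅, 0⟩

/-- The pure form of `K`. -/
def pur (K : CMI n) : CMI n := ⟨K.cond, removeFrom K.cond K.parts⟩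

/-- The set `𝕀_K` of repeated indices of `K`, those that lie in at least two members of the
collection (counted with multiplicity). It is empty for `k ≤ 1`. -/
def rep (K : CMI n) : Finset (Fin n) :=
  Finset.univ.filter fun q => 2 ≤ K.parts.countP (q ∈ ·)

/-- The collection `⟨P_1, …, P_t⟩` of the nonempty sets among `Q_i \ 𝕀_K`. -/
def residual (K : CMI n) : Multiset (Finset (Fin n)) := removeFrom K.rep K.parts

/-- The canonical form of a CMI `K` in pure form. -/
def can (K : CMI n) : CMI n :=
  if K.parts.card ≤ 1 then triv
  else if K.rep = ∅ then ⟨K.cond, K.residual⟩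
  else if K.residual.card ≤ 1 then ⟨K.cond, {K.rep, K.rep}⟩
  else ⟨K.cond, K.rep ::ₘ K.rep ::ₘ K.residual⟩

/-- `can(pur(K)) = (C, ⟨𝕀, 𝕀, P_1, …, P_t⟩)`. In this form `C`, `𝕀`, `P_1, …, P_t` are disjoint and the
`P_i` are nonempty, so that `C`, `𝕀` and `⟨P_1, …, P_t⟩` are recovered from it as
`K.canPur.cond`, `K.canPur.rep` and `K.canPur.residual`. Note that `t ≠ 1` here: a single nonempty
`Q_i \ 𝕀` is dropped by `can`. -/
def canPur (K : CMI n) : CMI n := K.pur.can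

/-- `R_K^{K'}`, called "`K'` conditioning on `K`". -/
def condOn (K K' : CMI n) : CMI n :=
  let I := K.canPur.rep
  let C' := K'.canPur.cond
  let I' := K'.canPur.rep
  let T := removeFrom I K'.canPur.residual
  if I' \ I = ∅ then
    if T.card ≤ 1 then triv else ⟨C' \ I, T⟩
  else
    if T.card ≤ 1 then ⟨C' \ I, {I' \ I, I' \ I}⟩
    else ⟨C' \ I, (I' \ I) ::ₘ (I' \ I) ::ₘ T⟩

/-- `K'` is a sub-CMI of `K`. The three alternatives are:
`K'` is degenerate; `can(pur(K''))` is degenerate and `C ⊆ C'`; `can(pur(K''))` is not degenerate and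
satisfies the containment and separation conditions. Here `K'' = R_K^{K'}`, and the letters with
zero, one and two primes belong to `can(pur(K))`, `can(pur(K'))` and `can(pur(K''))`. The first
alternative is expressed through the canonical form of `K'`, so that the whole condition is
combinatorial. -/
def IsSubCMI (K' K : CMI n) : Prop :=
  let C := K.canPur.cond
  let Ps := K.canPur.residual
  let C' := K'.canPur.cond
  let K'' := condOn K K'
  let C'' := K''.canPur.cond
  let Ps'' := K''.canPur.residual
  let P := Ps.sup
  let S := C ∪ P
  let P'' := Ps''.sup
  K'.canPur = triv ∨
  (K''.canPur = triv ∧ C ⊆ C') ∨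
  (K''.canPur ≠ triv ∧ K''.canPur.rep = ∅ ∧ P'' ⊆ P ∧ C ⊆ C'' ∧ C'' ⊆ S \ P'' ∧
    ∀ j₁ j₂ : Ps'', j₁ ≠ j₂ →
      ∀ m₁ ∈ (j₁ : Finset (Fin n)), ∀ m₂ ∈ (j₂ : Finset (Fin n)),
        ∃ i₁ i₂ : Ps, i₁ ≠ i₂ ∧
          m₁ ∈ (i₁ : Finset (Fin n)) ∧ m₂ ∈ (i₂ : Finset (Fin n)))

end CMI

/-!
Everything is expressed through one relation: `K.Sep a b` says that `a` and `b` lie outside the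
conditioning set `C` of `K` and in two distinct members of its collection. The repeated indices of
the canonical form are those with `K.Sep a a`, and its residual sets are disjoint and determined, for
the purposes of the theorem, by the pairs `K.Sep a b` of non-repeated indices. `isSubCMI_iff`
rewrites the sub-CMI relation in these terms: whenever `K'` separates `a` and `b`, one has `C ⊆ C'`,
and if neither index is repeated in `K`, then `K` separates them too and `C'` consists of
conditioning, repeated and residual indices of `K`.

Sufficiency. Validity of `K` means that, conditionally on every value of `X_C` of positive
probability, the blocks `X_{Q_j}` are independent (`isValid_iff`). A repeated index is then
independent of itself, so it is conditionally constant (`BlocksIndep.ae_const`), and constant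
coordinates can be deleted from all blocks (`BlocksIndep.of_sdiff`). Unless this
leaves at most one nonempty block of `K'`, every block of `K` now meets at most one block of `K'`,
and `C' \ C` lies in the union of the blocks of `K`; then independence survives conditioning and
regrouping (`BlocksIndep.cond_agree`).

Necessity. If `K'` separates `a` and `b` and the condition fails, one of two distributions of bits
satisfies `K` but not `K'`. If some `c ∈ C` is not in `C'`, let `X_a`, `X_b` and `X_c` be the same
uniform bit. If `K` does not separate `a` and `b`, let `X_a = X_b` be a uniform bit. If some `c ∈ C'`
is neither a conditioning, a repeated nor a residual index of `K`, let `X_a` and `X_b` be independent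
uniform bits and `X_c` their sum modulo `2`. All these have finite entropy, so the finite-entropy
and the general notions of implication coincide.
-/

/-! ### Separated pairs in a collection of sets -/

/-- Two members of the collection `M`, distinct as members (they may be equal as sets), contain
`a` and `b` respectively. The second member is taken from `M.erase A`, so that multiplicities
count. -/
def Separates {ι : Type*} [DecidableEq ι] (M : Multiset (Finset ι)) (a b : ι) : Prop :=
  ∃ A ∈ M, ∃ B ∈ M.erase A, a ∈ A ∧ b ∈ B

namespace Separates

variable {ι : Type*} [DecidableEq ι] {M : Multiset (Finset ι)} {a b : ι}

lemma symm (h : Separates M a b) : Separates M b a := by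
  obtain ⟨A, hA, B, hB, ha, hb⟩ := h
  refine ⟨B, Multiset.mem_of_mem_erase hB, A, ?_, hb, ha⟩
  by_cases hAB : A = B
  · subst hAB; exact hB
  · exact (Multiset.mem_erase_of_ne hAB).2 hA

lemma left_mem (h : Separates M a b) : ∃ A ∈ M, a ∈ A :=
  let ⟨A, hA, _, _, ha, _⟩ := h; ⟨A, hA, ha⟩

@[simp] lemma not_zero : ¬ Separates (0 : Multiset (Finset ι)) a b := by
  simp [Separates]

lemma cons_iff {X : Finset ι} :
    Separates (X ::ₘ M) a b ↔
      (a ∈ X ∧ ∃ B ∈ M, b ∈ B) ∨ (b ∈ X ∧ ∃ B ∈ M, a ∈ B) ∨ Separates M a b := by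
  constructor
  · rintro ⟨A, hA, B, hB, ha, hb⟩
    by_cases hAX : A = X
    · subst hAX
      rw [Multiset.erase_cons_head] at hB
      exact Or.inl ⟨ha, B, hB, hb⟩
    · rw [Multiset.erase_cons_tail _ (Ne.symm hAX)] at hB
      have hA' : A ∈ M := (Multiset.mem_cons.1 hA).resolve_left hAX
      rcases Multiset.mem_cons.1 hB with rfl | hB
      · exact Or.inr (Or.inl ⟨hb, A, hA', ha⟩)
      · exact Or.inr (Or.inr ⟨A, hA', B, hB, ha, hb⟩)
  · have key : ∀ {a b}, (a ∈ X ∧ ∃ B ∈ M, b ∈ B) → Separates (X ::ₘ M) a b := by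
      rintro a b ⟨ha, B, hB, hb⟩
      exact ⟨X, Multiset.mem_cons_self _ _, B, by rwa [Multiset.erase_cons_head], ha, hb⟩
    rintro (h | h | ⟨A, hA, B, hB, ha, hb⟩)
    · exact key h
    · exact (key h).symm
    · refine ⟨A, Multiset.mem_cons_of_mem hA, B, ?_, ha, hb⟩
      exact Multiset.mem_of_le (Multiset.erase_le_erase A (Multiset.le_cons_self M X)) hB

lemma iff_exists_coe :
    Separates M a b ↔
      ∃ i₁ i₂ : M, i₁ ≠ i₂ ∧ a ∈ (i₁ : Finset ι) ∧ b ∈ (i₂ : Finset ι) := by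
  constructor
  · rintro ⟨A, hA, B, hB, ha, hb⟩
    have hA0 : 0 < M.count A := Multiset.count_pos.2 hA
    have hB0 : 0 < M.count B := Multiset.count_pos.2 (Multiset.mem_of_mem_erase hB)
    by_cases hAB : A = B
    · subst hAB
      have h2 : 1 < M.count A := by
        have := Multiset.count_pos.2 hB
        rw [Multiset.count_erase_self] at this
        omega
      refine ⟨⟨A, ⟨0, hA0⟩⟩, ⟨A, ⟨1, h2⟩⟩, fun h => ?_, ha, hb⟩
      have := congrArg (fun i : M => (i.2 : ℕ)) h
      exact zero_ne_one this
    · refine ⟨⟨A, ⟨0, hA0⟩⟩, ⟨B, ⟨0, hB0⟩⟩, ?_, ha, hb⟩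
      intro h
      exact hAB (congrArg Sigma.fst h)
  · rintro ⟨⟨A, r⟩, ⟨B, s⟩, hne, ha, hb⟩
    have hA0 : A ∈ M := Multiset.count_pos.1 (lt_of_le_of_lt (Nat.zero_le _) r.2)
    have hB0 : B ∈ M := Multiset.count_pos.1 (lt_of_le_of_lt (Nat.zero_le _) s.2)
    refine ⟨A, hA0, B, ?_, ha, hb⟩
    by_cases hAB : A = B
    · subst hAB
      rw [← Multiset.count_pos, Multiset.count_erase_self]
      have : r ≠ s := fun h => hne (by rw [h])
      have := Fin.val_ne_of_ne this
      have := r.2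
      have := s.2
      omega
    · exact (Multiset.mem_erase_of_ne (Ne.symm hAB)).2 hB0

end Separates

namespace CMI

variable {n : ℕ}

lemma mem_removeFrom {A X : Finset (Fin n)} {M : Multiset (Finset (Fin n))} :
    X ∈ removeFrom A M ↔ X ≠ ∅ ∧ ∃ Y ∈ M, Y \ A = X := by
  simp only [removeFrom, Multiset.mem_filter, Multiset.mem_map]
  tauto

lemma exists_mem_removeFrom {A : Finset (Fin n)} {M : Multiset (Finset (Fin n))} {a : Fin n} :
    (∃ X ∈ removeFrom A M, a ∈ X) ↔ a ∉ A ∧ ∃ X ∈ M, a ∈ X := by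
  constructor
  · rintro ⟨X, hX, ha⟩
    obtain ⟨-, Y, hY, rfl⟩ := mem_removeFrom.1 hX
    rw [Finset.mem_sdiff] at ha
    exact ⟨ha.2, Y, hY, ha.1⟩
  · rintro ⟨hA, Y, hY, ha⟩
    have : a ∈ Y \ A := Finset.mem_sdiff.2 ⟨ha, hA⟩
    exact ⟨Y \ A, mem_removeFrom.2 ⟨Finset.ne_empty_of_mem this, Y, hY, rfl⟩, this⟩

lemma removeFrom_cons (A X : Finset (Fin n)) (M : Multiset (Finset (Fin n))) :
    removeFrom A (X ::ₘ M) = if X \ A = ∅ then removeFrom A M else (X \ A) ::ₘ removeFrom A M := by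
  unfold removeFrom
  rw [Multiset.map_cons]
  split_ifs with h
  · exact Multiset.filter_cons_of_neg _ (not_not.2 h)
  · exact Multiset.filter_cons_of_pos _ h

lemma separates_removeFrom {A : Finset (Fin n)} {M : Multiset (Finset (Fin n))} {a b : Fin n} :
    Separates (removeFrom A M) a b ↔ a ∉ A ∧ b ∉ A ∧ Separates M a b := by
  induction M using Multiset.induction_on with
  | empty => simp [removeFrom]
  | cons X M ih =>
    rw [removeFrom_cons]
    split_ifs with h
    · have h' : ∀ c ∈ X, c ∈ A := fun c hc => Finset.sdiff_eq_empty_iff_subset.1 h hc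
      rw [ih, Separates.cons_iff]
      have := h' a
      have := h' b
      tauto
    · rw [Separates.cons_iff, Separates.cons_iff, ih, exists_mem_removeFrom,
        exists_mem_removeFrom, Finset.mem_sdiff, Finset.mem_sdiff]
      by_cases ha : a ∈ A <;> by_cases hb : b ∈ A <;> simp [ha, hb]

/-- A collection of nonempty sets has at least two members exactly when it separates some pair. -/
lemma one_lt_card_removeFrom_iff {A : Finset (Fin n)} {M : Multiset (Finset (Fin n))} :
    1 < (removeFrom A M).card ↔ ∃ a b, Separates (removeFrom A M) a b := by
  constructor
  · intro h
    obtain ⟨X, hX⟩ := Multiset.card_pos_iff_exists_mem.1 (lt_trans zero_lt_one h)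
    have hc : 0 < ((removeFrom A M).erase X).card := by
      rw [Multiset.card_erase_of_mem hX]
      exact Nat.sub_pos_of_lt h
    obtain ⟨Y, hY⟩ := Multiset.card_pos_iff_exists_mem.1 hc
    obtain ⟨a, ha⟩ := Finset.nonempty_iff_ne_empty.2 (mem_removeFrom.1 hX).1
    obtain ⟨b, hb⟩ :=
      Finset.nonempty_iff_ne_empty.2 (mem_removeFrom.1 (Multiset.mem_of_mem_erase hY)).1
    exact ⟨a, b, X, hX, Y, hY, ha, hb⟩
  · rintro ⟨a, b, X, hX, Y, hY, -, -⟩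
    have := Multiset.card_pos_iff_exists_mem.2 ⟨Y, hY⟩
    rw [Multiset.card_erase_of_mem hX] at this
    exact Nat.lt_of_sub_pos this

lemma exists_separates_of_mem {A X : Finset (Fin n)} {M : Multiset (Finset (Fin n))} {a : Fin n}
    (h : 1 < (removeFrom A M).card) (hX : X ∈ removeFrom A M) (ha : a ∈ X) :
    ∃ b, Separates (removeFrom A M) a b := by
  have hc : 0 < ((removeFrom A M).erase X).card := by
    rw [Multiset.card_erase_of_mem hX]
    exact Nat.sub_pos_of_lt h
  obtain ⟨Y, hY⟩ := Multiset.card_pos_iff_exists_mem.1 hc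
  obtain ⟨b, hb⟩ :=
    Finset.nonempty_iff_ne_empty.2 (mem_removeFrom.1 (Multiset.mem_of_mem_erase hY)).1
  exact ⟨b, X, hX, Y, hY, ha, hb⟩

lemma mem_rep {K : CMI n} {a : Fin n} : a ∈ K.rep ↔ Separates K.parts a a := by
  have key : ∀ M : Multiset (Finset (Fin n)),
      (0 < M.countP (a ∈ ·) ↔ ∃ X ∈ M, a ∈ X) ∧ (2 ≤ M.countP (a ∈ ·) ↔ Separates M a a) := by
    intro M
    refine ⟨Multiset.countP_pos, ?_⟩
    induction M using Multiset.induction_on with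
    | empty => simp
    | cons X M ih =>
      have h1 : 0 < M.countP (a ∈ ·) ↔ ∃ X ∈ M, a ∈ X := Multiset.countP_pos
      rw [Separates.cons_iff, ← ih, ← h1]
      by_cases hX : a ∈ X
      · rw [Multiset.countP_cons_of_pos (p := (a ∈ ·)) M hX]
        simp only [hX, true_and]
        omega
      · rw [Multiset.countP_cons_of_neg (p := (a ∈ ·)) M hX]
        simp only [hX, false_and, false_or]
  simpa [rep] using (key K.parts).2

/-! ### Canonical forms in terms of separated pairs -/

/-- `K.Sep a b` : the indices `a`, `b` lie outside the conditioning set and in two distinct members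
of the collection. Validity of `K` forces `X_a` and `X_b` to be independent given `X_C`; for
`a = b` it forces `X_a` to be a function of `X_C`. -/
def Sep (K : CMI n) (a b : Fin n) : Prop :=
  a ∉ K.cond ∧ b ∉ K.cond ∧ Separates K.parts a b

lemma Sep.symm {K : CMI n} {a b : Fin n} (h : K.Sep a b) : K.Sep b a :=
  ⟨h.2.1, h.1, h.2.2.symm⟩

lemma separates_pur {K : CMI n} {a b : Fin n} : Separates K.pur.parts a b ↔ K.Sep a b :=
  separates_removeFrom

lemma mem_rep_pur {K : CMI n} {a : Fin n} : a ∈ K.pur.rep ↔ K.Sep a a := by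
  rw [mem_rep, separates_pur]

lemma separates_residual_pur {K : CMI n} {a b : Fin n} :
    Separates K.pur.residual a b ↔ ¬ K.Sep a a ∧ ¬ K.Sep b b ∧ K.Sep a b := by
  rw [residual, separates_removeFrom, separates_pur, mem_rep_pur, mem_rep_pur]

lemma removeFrom_eq_self {A : Finset (Fin n)} {M : Multiset (Finset (Fin n))}
    (h : ∀ X ∈ M, X ≠ ∅ ∧ Disjoint X A) : removeFrom A M = M := by
  unfold removeFrom
  have hmap : M.map (· \ A) = M := by
    conv_rhs => rw [← Multiset.map_id M]
    exact Multiset.map_congr rfl fun X hX => Finset.sdiff_eq_self_of_disjoint (h X hX).2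
  rw [hmap, Multiset.filter_eq_self]
  exact fun X hX => (h X hX).1

lemma residual_of_rep_eq_empty {K : CMI n} (h : K.rep = ∅) (h0 : ∀ X ∈ K.parts, X ≠ ∅) :
    K.residual = K.parts := by
  rw [residual, h]
  exact removeFrom_eq_self fun X hX => ⟨h0 X hX, Finset.disjoint_empty_right X⟩

lemma one_lt_card_parts_of_sep {K : CMI n} {a b : Fin n} (h : K.Sep a b) :
    1 < K.pur.parts.card :=
  one_lt_card_removeFrom_iff.2 ⟨a, b, separates_pur.2 h⟩

/-- The four cases in the definition of the canonical form, in terms of separated pairs. -/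
lemma canPur_cases (K : CMI n) :
    ((∀ a b, ¬ K.Sep a b) ∧ K.canPur = triv) ∨
    ((∃ a b, K.Sep a b) ∧ K.pur.rep = ∅ ∧ 1 < K.pur.residual.card ∧
      K.canPur = ⟨K.cond, K.pur.residual⟩) ∨
    ((∃ a b, K.Sep a b) ∧ K.pur.rep ≠ ∅ ∧ ¬ 1 < K.pur.residual.card ∧
      K.canPur = ⟨K.cond, {K.pur.rep, K.pur.rep}⟩) ∨
    ((∃ a b, K.Sep a b) ∧ K.pur.rep ≠ ∅ ∧ 1 < K.pur.residual.card ∧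
      K.canPur = ⟨K.cond, K.pur.rep ::ₘ K.pur.rep ::ₘ K.pur.residual⟩) := by
  by_cases h1 : K.pur.parts.card ≤ 1
  · left
    refine ⟨fun a b hab => ?_, by rw [canPur, can, if_pos h1]⟩
    exact absurd (one_lt_card_parts_of_sep hab) (not_lt.2 h1)
  · have hs : ∃ a b, K.Sep a b := by
      obtain ⟨a, b, hab⟩ := one_lt_card_removeFrom_iff.1 (not_le.1 h1)
      exact ⟨a, b, separates_pur.1 hab⟩
    right
    rw [canPur, can, if_neg h1]
    by_cases h2 : K.pur.rep = ∅
    · left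
      rw [if_pos h2]
      refine ⟨hs, h2, ?_, rfl⟩
      rw [residual_of_rep_eq_empty h2 fun X hX => (mem_removeFrom.1 hX).1]
      exact not_le.1 h1
    · right
      rw [if_neg h2]
      by_cases h3 : K.pur.residual.card ≤ 1
      · left
        rw [if_pos h3]
        exact ⟨hs, h2, not_lt.2 h3, rfl⟩
      · right
        rw [if_neg h3]
        exact ⟨hs, h2, not_le.1 h3, rfl⟩

lemma canPur_cond_of_sep {K : CMI n} {a b : Fin n} (h : K.Sep a b) :
    K.canPur.cond = K.cond := by
  rcases K.canPur_cases with ⟨h0, -⟩ | ⟨-, -, -, h1⟩ | ⟨-, -, -, h1⟩ | ⟨-, -, -, h1⟩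
  · exact absurd h (h0 a b)
  all_goals rw [h1]

lemma canPur_eq_triv_iff {K : CMI n} : K.canPur = triv ↔ ∀ a b, ¬ K.Sep a b := by
  constructor
  · intro h a b hab
    rcases K.canPur_cases with ⟨h0, -⟩ | ⟨-, -, h2, h1⟩ | ⟨-, -, -, h1⟩ | ⟨-, -, -, h1⟩
    · exact absurd hab (h0 a b)
    all_goals
      rw [h1] at h
      have h' := congrArg (fun K : CMI n => K.parts.card) h
      simp [triv] at h'
    rw [h'] at h2
    simp at h2
  · intro h
    rcases K.canPur_cases with ⟨-, h1⟩ | ⟨⟨a, b, hab⟩, -⟩ | ⟨⟨a, b, hab⟩, -⟩ | ⟨⟨a, b, hab⟩, -⟩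
    · exact h1
    all_goals exact absurd hab (h a b)

lemma mem_canPur_rep {K : CMI n} {a : Fin n} : a ∈ K.canPur.rep ↔ K.Sep a a := by
  rw [← mem_rep_pur]
  have hR : ¬ Separates K.pur.residual a a := by
    rw [separates_residual_pur]; tauto
  have hR' : ∀ X ∈ K.pur.residual, a ∈ X → a ∉ K.pur.rep := fun X hX ha =>
    (exists_mem_removeFrom.1 ⟨X, hX, ha⟩).1
  rw [mem_rep]
  rcases K.canPur_cases with ⟨h0, h1⟩ | ⟨-, h0, -, h1⟩ | ⟨-, -, -, h1⟩ | ⟨-, -, -, h1⟩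
  · have := h0 a a
    rw [← mem_rep_pur] at this
    simp [h1, triv, this]
  · rw [h1, h0]
    simpa using hR
  · rw [h1]
    simp [Separates]
  · rw [h1]
    simp only [Separates.cons_iff, hR, or_false, Multiset.mem_cons, or_self,
      exists_eq_or_imp]
    tauto

lemma canPur_residual (K : CMI n) :
    K.canPur.residual = if 1 < K.pur.residual.card then K.pur.residual else 0 := by
  have hrep : K.canPur.rep = K.pur.rep := by
    ext a; rw [mem_canPur_rep, mem_rep_pur]
  have hR : removeFrom K.pur.rep K.pur.residual = K.pur.residual := by
    refine removeFrom_eq_self fun X hX => ?_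
    obtain ⟨hne, Y, -, rfl⟩ := mem_removeFrom.1 hX
    exact ⟨hne, Finset.sdiff_disjoint⟩
  rw [residual, hrep]
  rcases K.canPur_cases with ⟨h0, h1⟩ | ⟨-, -, h0, h1⟩ | ⟨-, -, h0, h1⟩ | ⟨-, -, h0, h1⟩
  · have : ¬ 1 < K.pur.residual.card := by
      intro h
      obtain ⟨a, b, hab⟩ := one_lt_card_removeFrom_iff.1 h
      exact h0 a b (separates_residual_pur.1 hab).2.2
    rw [h1, if_neg this]
    simp [triv, removeFrom]
  · rw [h1, if_pos h0]
    exact hR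
  · rw [h1, if_neg h0]
    simp [removeFrom]
  · rw [h1, if_pos h0]
    simp only [removeFrom_cons, Finset.sdiff_self, if_true]
    exact hR

lemma separates_canPur_residual {K : CMI n} {a b : Fin n} :
    Separates K.canPur.residual a b ↔ ¬ K.Sep a a ∧ ¬ K.Sep b b ∧ K.Sep a b := by
  rw [canPur_residual]
  split_ifs with h
  · exact separates_residual_pur
  · simp only [Separates.not_zero, false_iff]
    exact fun h' => h (one_lt_card_removeFrom_iff.2 ⟨a, b, separates_residual_pur.2 h'⟩)

lemma mem_sup_canPur_residual {K : CMI n} {a : Fin n} :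
    a ∈ K.canPur.residual.sup ↔ ∃ b, Separates K.canPur.residual a b := by
  have hsup : a ∈ K.canPur.residual.sup ↔ ∃ X ∈ K.canPur.residual, a ∈ X := by
    generalize K.canPur.residual = M
    induction M using Multiset.induction_on with
    | empty => simp
    | cons X M ih => simp [ih]
  rw [hsup]
  constructor
  · rintro ⟨X, hX, ha⟩
    rw [canPur_residual] at hX ⊢
    split_ifs at hX ⊢ with h
    · exact exists_separates_of_mem h hX ha
    · simp at hX
  · rintro ⟨b, hb⟩
    exact hb.left_mem

/-! ### The sub-CMI relation in terms of separated pairs -/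

lemma condOn_eq_triv_or (K K' : CMI n) :
    condOn K K' = triv ∨ (condOn K K').cond = K'.canPur.cond \ K.canPur.rep := by
  unfold condOn
  dsimp only
  split_ifs <;> simp

lemma separates_removeFrom_canPur {K K' : CMI n} {a b : Fin n} :
    Separates (removeFrom K.canPur.rep K'.canPur.residual) a b ↔
      ¬ K.Sep a a ∧ ¬ K.Sep b b ∧ ¬ K'.Sep a a ∧ ¬ K'.Sep b b ∧ K'.Sep a b := by
  rw [separates_removeFrom, mem_canPur_rep, mem_canPur_rep, separates_canPur_residual]

/-- An index repeated in `K'` but not in `K` is repeated in `R_K^{K'}`. -/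
lemma condOn_sep_self {K K' : CMI n} {d : Fin n} (hd : ¬ K.Sep d d) (hd' : K'.Sep d d) :
    (condOn K K').Sep d d := by
  have hD : d ∈ K'.canPur.rep \ K.canPur.rep := by
    rw [Finset.mem_sdiff, mem_canPur_rep, mem_canPur_rep]
    exact ⟨hd', hd⟩
  have hC : d ∉ K'.canPur.cond \ K.canPur.rep := by
    rw [canPur_cond_of_sep hd', Finset.mem_sdiff]
    exact fun h => hd'.1 h.1
  unfold condOn
  dsimp only
  rw [if_neg (Finset.ne_empty_of_mem hD)]
  split_ifs
  · refine ⟨hC, hC, ?_⟩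
    exact Separates.cons_iff.2 (Or.inl ⟨hD, _, Multiset.mem_singleton_self _, hD⟩)
  · refine ⟨hC, hC, ?_⟩
    exact Separates.cons_iff.2 (Or.inl ⟨hD, _, Multiset.mem_cons_self _ _, hD⟩)

/-- If every index repeated in `K'` is repeated in `K`, the pairs separated by `R_K^{K'}` are those
separated by `K'` outside the repeated indices of `K`. -/
lemma condOn_sep_iff {K K' : CMI n} (h : ∀ a, ¬ K.Sep a a → ¬ K'.Sep a a) {a b : Fin n} :
    (condOn K K').Sep a b ↔ ¬ K.Sep a a ∧ ¬ K.Sep b b ∧ K'.Sep a b := by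
  have hD : K'.canPur.rep \ K.canPur.rep = ∅ := by
    rw [Finset.sdiff_eq_empty_iff_subset]
    intro d hd
    rw [mem_canPur_rep] at hd ⊢
    by_contra hd'
    exact h d hd' hd
  have hT := @separates_removeFrom_canPur n K K' a b
  have hab : Separates (removeFrom K.canPur.rep K'.canPur.residual) a b ↔
      ¬ K.Sep a a ∧ ¬ K.Sep b b ∧ K'.Sep a b := by
    rw [hT]
    have := h a
    have := h b
    tauto
  unfold condOn
  dsimp only
  rw [if_pos hD]
  split_ifs with h1
  · have h2 : ¬ Separates (removeFrom K.canPur.rep K'.canPur.residual) a b := fun h2 =>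
      absurd (one_lt_card_removeFrom_iff.2 ⟨a, b, h2⟩) (not_lt.2 h1)
    rw [← hab]
    simp [Sep, triv, h2]
  · rw [← hab]
    refine ⟨fun h3 => h3.2.2, fun h3 => ?_⟩
    have h4 : K'.Sep a b := (hab.1 h3).2.2
    refine ⟨?_, ?_, h3⟩
    all_goals
      rw [canPur_cond_of_sep h4, Finset.mem_sdiff]
      intro h5
    · exact h4.1 h5.1
    · exact h4.2.1 h5.1

lemma condOn_canPur_eq_triv_iff {K K' : CMI n} :
    (condOn K K').canPur = triv ↔ ∀ a b, ¬ K.Sep a a → ¬ K.Sep b b → ¬ K'.Sep a b := by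
  rw [canPur_eq_triv_iff]
  by_cases h : ∀ a, ¬ K.Sep a a → ¬ K'.Sep a a
  · refine forall₂_congr fun a b => ?_
    rw [condOn_sep_iff h]
    tauto
  · push Not at h
    obtain ⟨d, hd, hd'⟩ := h
    exact ⟨fun h => absurd (condOn_sep_self hd hd') (h d d), fun h => absurd hd' (h d d hd hd)⟩

lemma condOn_canPur_rep_eq_empty_iff {K K' : CMI n} :
    (condOn K K').canPur.rep = ∅ ↔ ∀ a, ¬ K.Sep a a → ¬ K'.Sep a a := by
  rw [Finset.eq_empty_iff_forall_notMem]
  simp only [mem_canPur_rep]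
  constructor
  · exact fun h a ha ha' => h a (condOn_sep_self ha ha')
  · intro h a
    rw [condOn_sep_iff h]
    have := h a
    tauto

lemma condOn_canPur_cond {K K' : CMI n} (h : (condOn K K').canPur ≠ triv) :
    (condOn K K').canPur.cond = K'.cond \ K.canPur.rep := by
  have h' := h
  rw [Ne, canPur_eq_triv_iff] at h'
  rw [Ne, condOn_canPur_eq_triv_iff] at h
  push Not at h h'
  obtain ⟨a, b, hab⟩ := h'
  obtain ⟨a', b', -, -, hab'⟩ := h
  rw [canPur_cond_of_sep hab]
  rcases condOn_eq_triv_or K K' with h0 | h0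
  · rw [h0] at hab
    simp [Sep, triv] at hab
  · rw [h0, canPur_cond_of_sep hab']

/-- The sub-CMI relation in terms of separated pairs: whenever `K'` separates `a` and `b`, the
conditioning set of `K` lies in that of `K'`; and if moreover neither `a` nor `b` is repeated in `K`,
then `K` separates `a` and `b`, and every conditioning index of `K'` is a conditioning, a repeated
or a residual index of `K`. -/
theorem isSubCMI_iff {K K' : CMI n} :
    IsSubCMI K' K ↔ ∀ a b, K'.Sep a b → K.cond ⊆ K'.cond ∧
      (¬ K.Sep a a → ¬ K.Sep b b → K.Sep a b ∧
        ∀ m ∈ K'.cond, m ∉ K.cond → ¬ K.Sep m m → ∃ c, ¬ K.Sep c c ∧ K.Sep m c) := by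
  have hsup : ∀ m, m ∈ K.canPur.residual.sup ↔ ¬ K.Sep m m ∧ ∃ c, ¬ K.Sep c c ∧ K.Sep m c := by
    intro m
    simp only [mem_sup_canPur_residual, separates_canPur_residual, exists_and_left]
  unfold IsSubCMI
  dsimp only
  constructor
  · rintro (h | ⟨h, hC⟩ | ⟨hne, hrep, -, hC, hC', hsep⟩) a b hab
    · exact absurd hab (canPur_eq_triv_iff.1 h a b)
    · have h0 := condOn_canPur_eq_triv_iff.1 h a b
      refine ⟨?_, fun ha hb => absurd hab (h0 ha hb)⟩
      have : ∃ c, K.Sep c c := by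
        by_contra! hc
        exact h0 (hc a) (hc b) hab
      obtain ⟨c, hc⟩ := this
      rwa [canPur_cond_of_sep hc, canPur_cond_of_sep hab] at hC
    · rw [condOn_canPur_rep_eq_empty_iff] at hrep
      rw [condOn_canPur_cond hne] at hC hC'
      have hsep' : ∀ a b, ¬ K.Sep a a → ¬ K.Sep b b → K'.Sep a b → K.Sep a b := by
        intro a b ha hb hab
        have h1 : Separates (condOn K K').canPur.residual a b := by
          rw [separates_canPur_residual]
          simp only [condOn_sep_iff hrep]
          have := hrep a ha
          have := hrep b hb
          tauto
        obtain ⟨j₁, j₂, hj, hj₁, hj₂⟩ := Separates.iff_exists_coe.1 h1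
        exact (separates_canPur_residual.1
          (Separates.iff_exists_coe.2 (hsep j₁ j₂ hj a hj₁ b hj₂))).2.2
      have hne' := hne
      rw [Ne, condOn_canPur_eq_triv_iff] at hne'
      push Not at hne'
      obtain ⟨a', b', ha', hb', hab'⟩ := hne'
      rw [canPur_cond_of_sep (hsep' a' b' ha' hb' hab')] at hC hC'
      refine ⟨hC.trans Finset.sdiff_subset, fun ha hb => ⟨hsep' a b ha hb hab, ?_⟩⟩
      intro m hm hmC hmI
      have h2 := hC' (Finset.mem_sdiff.2 ⟨hm, fun h => hmI (mem_canPur_rep.1 h)⟩)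
      rw [Finset.mem_sdiff, Finset.mem_union, hsup] at h2
      exact (h2.1.resolve_left hmC).2
  · intro h
    by_cases hN' : ∀ a b, ¬ K'.Sep a b
    · exact Or.inl (canPur_eq_triv_iff.2 hN')
    right
    push Not at hN'
    obtain ⟨a₀, b₀, h₀⟩ := hN'
    have hCC := (h a₀ b₀ h₀).1
    by_cases hne : (condOn K K').canPur = triv
    · refine Or.inl ⟨hne, ?_⟩
      rw [canPur_cond_of_sep h₀]
      by_cases hN : ∃ a b, K.Sep a b
      · obtain ⟨a, b, hab⟩ := hN
        rwa [canPur_cond_of_sep hab]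
      · push Not at hN
        rw [canPur_eq_triv_iff.2 hN]
        exact Finset.empty_subset _
    · right
      have hrep : ∀ a, ¬ K.Sep a a → ¬ K'.Sep a a := fun a ha ha' => ha ((h a a ha').2 ha ha).1
      have hres : ∀ {a b}, Separates (condOn K K').canPur.residual a b →
          Separates K.canPur.residual a b := by
        intro a b hab
        rw [separates_canPur_residual] at hab ⊢
        obtain ⟨ha, hb, hab⟩ := (condOn_sep_iff hrep).1 hab.2.2
        exact ⟨ha, hb, ((h a b hab).2 ha hb).1⟩
      have hne' := hne
      rw [condOn_canPur_eq_triv_iff] at hne'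
      push Not at hne'
      obtain ⟨a, b, ha, hb, hab⟩ := hne'
      obtain ⟨habK, hm⟩ := (h a b hab).2 ha hb
      refine ⟨hne, condOn_canPur_rep_eq_empty_iff.2 hrep, ?_, ?_, ?_, ?_⟩
      · intro m
        rw [mem_sup_canPur_residual, mem_sup_canPur_residual]
        exact fun ⟨c, hc⟩ => ⟨c, hres hc⟩
      · rw [condOn_canPur_cond hne, canPur_cond_of_sep habK]
        intro m hmC
        exact Finset.mem_sdiff.2 ⟨hCC hmC, fun hI => (mem_canPur_rep.1 hI).1 hmC⟩
      · rw [condOn_canPur_cond hne, canPur_cond_of_sep habK]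
        intro m hmC
        rw [Finset.mem_sdiff, mem_canPur_rep] at hmC
        rw [Finset.mem_sdiff, Finset.mem_union, hsup, mem_sup_canPur_residual]
        refine ⟨?_, ?_⟩
        · by_cases hmK : m ∈ K.cond
          · exact Or.inl hmK
          · exact Or.inr ⟨hmC.2, hm m hmC.1 hmK hmC.2⟩
        · rintro ⟨c, hc⟩
          exact ((condOn_sep_iff hrep).1 (separates_canPur_residual.1 hc).2.2).2.2.1 hmC.1
      · intro j₁ j₂ hj m₁ hm₁ m₂ hm₂
        exact Separates.iff_exists_coe.1
          (hres (Separates.iff_exists_coe.2 ⟨j₁, j₂, hj, hm₁, hm₂⟩))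

/-! ### Independence of blocks of coordinates -/

section Blocks

open MeasureTheory ProbabilityTheory

lemma agree_eq_preimage {α : Fin n → Type} (Q : Finset (Fin n)) (x : ∀ i, α i) :
    agree Q x = (fun ω : ∀ i, α i => Q.restrict ω) ⁻¹' {Q.restrict x} := by
  ext ω
  simp [agree, funext_iff, Finset.restrict]

variable {α : Fin n → Type} [∀ i, Countable (α i)] [∀ i, MeasurableSpace (α i)]
  [∀ i, DiscreteMeasurableSpace (α i)] {ι : Type*} {Q T : ι → Finset (Fin n)}
  {μ : Measure (∀ i, α i)}

/-- The blocks of coordinates `(ω_i)_{i ∈ Q_j}`, for `j : ι`, are mutually independent under `μ`. -/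
def BlocksIndep (Q : ι → Finset (Fin n)) (μ : Measure (∀ i, α i)) : Prop :=
  iIndepFun (fun j (ω : ∀ i, α i) => (Q j).restrict ω) μ

lemma measurableSet_comap_restrict_agree {A Q : Finset (Fin n)} (h : A ⊆ Q) (x : ∀ i, α i) :
    MeasurableSet[MeasurableSpace.comap (fun ω : ∀ i, α i => Q.restrict ω) inferInstance]
      (agree A x) := by
  refine ⟨{z | ∀ i (hi : i ∈ A), z ⟨i, h hi⟩ = x i}, MeasurableSet.of_discrete, ?_⟩
  ext ω
  simp [agree, Finset.restrict]

/-- Independence of blocks can be tested on the values of the blocks. -/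
lemma blocksIndep_iff [Fintype ι] [IsProbabilityMeasure μ] :
    BlocksIndep Q μ ↔
      ∀ x : ι → ∀ i, α i, μ (⋂ j, agree (Q j) (x j)) = ∏ j, μ (agree (Q j) (x j)) := by
  constructor
  · intro h x
    exact h.meas_iInter fun j => measurableSet_comap_restrict_agree subset_rfl (x j)
  · intro h
    obtain ⟨ω₀⟩ : Nonempty (∀ i, α i) := nonempty_of_isProbabilityMeasure μ
    unfold BlocksIndep
    rw [iIndepFun_iff_map_fun_eq_pi_map fun j => (Measurable.of_discrete).aemeasurable]
    refine Measure.ext_of_singleton fun z => ?_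
    have hz : ∀ j, ∃ x : ∀ i, α i, (Q j).restrict x = z j := by
      intro j
      refine ⟨fun i => if hi : i ∈ Q j then z j ⟨i, hi⟩ else ω₀ i, ?_⟩
      ext ⟨i, hi⟩
      simp [Finset.restrict, hi]
    choose x hx using hz
    rw [Measure.pi_singleton, Measure.map_apply Measurable.of_discrete (MeasurableSet.singleton _)]
    have h1 : (fun (ω : ∀ i, α i) j => (Q j).restrict ω) ⁻¹' {z} = ⋂ j, agree (Q j) (x j) := by
      ext ω
      simp only [agree_eq_preimage, hx, Set.mem_preimage, Set.mem_singleton_iff, Set.mem_iInter]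
      exact funext_iff
    rw [h1, h x]
    refine Finset.prod_congr rfl fun j _ => ?_
    rw [Measure.map_apply Measurable.of_discrete (MeasurableSet.singleton _), agree_eq_preimage, hx]

/-- Coordinates that are almost surely constant do not affect the independence of blocks. -/
lemma BlocksIndep.of_sdiff [IsProbabilityMeasure μ] {A : Finset (Fin n)}
    (hA : ∀ i ∈ A, ∃ c, ∀ᵐ ω ∂μ, ω i = c) (h : BlocksIndep (fun j => Q j \ A) μ) :
    BlocksIndep Q μ := by
  classical
  obtain ⟨ω₀⟩ : Nonempty (∀ i, α i) := nonempty_of_isProbabilityMeasure μ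
  have hA' : ∀ i, ∃ c, i ∈ A → ∀ᵐ ω ∂μ, ω i = c := by
    intro i
    by_cases hi : i ∈ A
    · exact (hA i hi).imp fun c hc _ => hc
    · exact ⟨ω₀ i, fun h => absurd h hi⟩
  choose c hc using hA'
  have hd : ∀ᵐ ω ∂μ, ∀ i ∈ A, ω i = c i := by
    rw [ae_all_iff]
    intro i
    by_cases hi : i ∈ A
    · simpa [hi] using hc i hi
    · simp [hi]
  have h2 := iIndepFun.comp h
    (fun j z (i : Q j) => if hi : (i : Fin n) ∈ Q j \ A then z ⟨i, hi⟩ else c i)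
    fun _ => Measurable.of_discrete
  refine (iIndepFun_congr fun j => ?_).1 h2
  filter_upwards [hd] with ω hω
  ext ⟨i, hi⟩
  by_cases hiA : i ∈ A
  · simp [hiA, hω i hiA]
  · simp [hiA]

/-- Blocks of which at most one is nonempty are independent. -/
lemma blocksIndep_of_subsingleton [Fintype ι] [IsProbabilityMeasure μ]
    (h : ∀ j₁ j₂, ∀ a ∈ T j₁, ∀ b ∈ T j₂, j₁ = j₂) : BlocksIndep T μ := by
  rw [blocksIndep_iff]
  intro x
  by_cases h0 : ∃ j, T j ≠ ∅
  · obtain ⟨j, hj⟩ := h0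
    obtain ⟨a, ha⟩ := Finset.nonempty_iff_ne_empty.2 hj
    have hT : ∀ k, k ≠ j → agree (T k) (x k) = Set.univ := by
      intro k hk
      refine Set.eq_univ_of_forall fun ω b hb => absurd (h k j b hb a ha) hk
    rw [Finset.prod_eq_single j (fun k _ hk => by rw [hT k hk, measure_univ])
      (fun h => absurd (Finset.mem_univ j) h)]
    congr 1
    refine Set.Subset.antisymm (Set.iInter_subset _ j) (Set.subset_iInter fun k => ?_)
    by_cases hk : k = j
    · rw [hk]
    · rw [hT k hk]
      exact Set.subset_univ _
  · push Not at h0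
    simp [h0, agree]

/-- A coordinate shared by two independent blocks is independent of itself, hence constant. -/
lemma BlocksIndep.ae_const [IsProbabilityMeasure μ] (h : BlocksIndep Q μ) {j₁ j₂ : ι}
    (hj : j₁ ≠ j₂) {a : Fin n} (h₁ : a ∈ Q j₁) (h₂ : a ∈ Q j₂) : ∃ c, ∀ᵐ ω ∂μ, ω a = c := by
  have hind : IndepFun (fun ω : ∀ i, α i => ω a) (fun ω => ω a) μ :=
    (iIndepFun.indepFun h hj).comp (φ := fun z : ∀ i : Q j₁, α i => z ⟨a, h₁⟩)
      (ψ := fun z : ∀ i : Q j₂, α i => z ⟨a, h₂⟩) Measurable.of_discrete Measurable.of_discrete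
  have hc : ∃ c, μ {ω | ω a = c} ≠ 0 := by
    by_contra! hc
    have h0 : μ (⋃ c, {ω | ω a = c}) = 0 := measure_iUnion_null hc
    rw [Set.eq_univ_of_forall (fun ω : ∀ i, α i => Set.mem_iUnion.2 ⟨ω a, rfl⟩),
      measure_univ] at h0
    exact one_ne_zero h0
  obtain ⟨c, hc⟩ := hc
  refine ⟨c, ?_⟩
  have h1 := hind.measure_inter_preimage_eq_mul {c} {c} MeasurableSet.of_discrete
    MeasurableSet.of_discrete
  rw [Set.inter_self] at h1
  have h2 : μ {ω | ω a = c} * 1 = μ {ω | ω a = c} * μ {ω | ω a = c} := by rw [mul_one]; exact h1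
  have h3 : (1 : ENNReal) = μ {ω | ω a = c} :=
    (ENNReal.mul_right_inj hc (measure_ne_top _ _)).1 h2
  exact (mem_ae_iff_prob_eq_one MeasurableSet.of_discrete).2 h3.symm

/-- Conditioning on some coordinates of independent blocks `Q_i` keeps blocks `T_j` independent,
provided that no `Q_i` meets two of the `T_j`. Both sides of the required identity are products over
`i` of probabilities of events that depend on the block `Q_i` only. -/
lemma BlocksIndep.cond_agree {κ : Type*} [Fintype ι] [Fintype κ] [IsProbabilityMeasure μ]
    (h : BlocksIndep Q μ) {D : Finset (Fin n)} {T : κ → Finset (Fin n)}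
    (hD : ∀ m ∈ D, ∃ i, m ∈ Q i) (hT : ∀ j, ∀ m ∈ T j, ∃ i, m ∈ Q i)
    (hQT : ∀ i j₁ j₂, ∀ a ∈ Q i, ∀ b ∈ Q i, a ∈ T j₁ → b ∈ T j₂ → j₁ = j₂)
    {y : ∀ i, α i} (hy : μ (agree D y) ≠ 0) : BlocksIndep T (μ[|agree D y]) := by
  classical
  have := cond_isProbabilityMeasure hy
  rw [blocksIndep_iff]
  intro x
  let E : ι → Set (∀ i, α i) := fun i => agree (D ∩ Q i) y
  let F : κ → ι → Set (∀ i, α i) := fun j i => agree (T j ∩ Q i) (x j)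
  have hE : agree D y = ⋂ i, E i := by
    ext ω
    simp only [agree, E, Set.mem_iInter, Set.mem_ofPred_eq, Finset.mem_inter]
    exact ⟨fun h i m hm => h m hm.1, fun h m hm => let ⟨i, hi⟩ := hD m hm; h i m ⟨hm, hi⟩⟩
  have hF : ∀ j, agree (T j) (x j) = ⋂ i, F j i := by
    intro j
    ext ω
    simp only [agree, F, Set.mem_iInter, Set.mem_ofPred_eq, Finset.mem_inter]
    exact ⟨fun h i m hm => h m hm.1, fun h m hm => let ⟨i, hi⟩ := hT j m hm; h i m ⟨hm, hi⟩⟩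
  have hEm : ∀ i, MeasurableSet[MeasurableSpace.comap
      (fun ω : ∀ i, α i => (Q i).restrict ω) inferInstance] (E i) := fun i =>
    measurableSet_comap_restrict_agree Finset.inter_subset_right y
  have hFm : ∀ j i, MeasurableSet[MeasurableSpace.comap
      (fun ω : ∀ i, α i => (Q i).restrict ω) inferInstance] (F j i) := fun j i =>
    measurableSet_comap_restrict_agree Finset.inter_subset_right (x j)
  have hμE : μ (agree D y) = ∏ i, μ (E i) := by
    rw [hE]
    exact iIndepFun.meas_iInter h hEm
  have hE0 : ∀ i, μ (E i) ≠ 0 := by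
    rw [hμE, Finset.prod_ne_zero_iff] at hy
    exact fun i => hy i (Finset.mem_univ i)
  have hprod : ∀ B : ι → Set (∀ i, α i), (∀ i, MeasurableSet[MeasurableSpace.comap
      (fun ω : ∀ i, α i => (Q i).restrict ω) inferInstance] (B i)) →
      (μ[|agree D y]) (⋂ i, B i) = ∏ i, (μ[|E i]) (B i) := by
    intro B hB
    simp only [cond_apply (MeasurableSet.of_discrete)]
    rw [Finset.prod_mul_distrib, hμE, ENNReal.prod_inv_distrib, hE, ← Set.iInter_inter_distrib]
    · congr 1
      exact iIndepFun.meas_iInter h fun i => (hEm i).inter (hB i)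
    · intro i _ j _ _
      exact Or.inl (hE0 i)
  have hL : ⋂ j, agree (T j) (x j) = ⋂ i, ⋂ j, F j i := by
    rw [Set.iInter_comm]
    exact Set.iInter_congr hF
  rw [hL, hprod _ fun i => MeasurableSet.iInter fun j => hFm j i]
  simp only [hF]
  rw [Finset.prod_congr rfl fun j _ => hprod _ (hFm j), Finset.prod_comm]
  refine Finset.prod_congr rfl fun i _ => ?_
  -- Within `Q i` the blocks `T j ∩ Q i` are empty with at most one exception.
  have := cond_isProbabilityMeasure (hE0 i)
  refine (blocksIndep_iff (Q := fun j => T j ∩ Q i)).1 (blocksIndep_of_subsingleton ?_) x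
  intro j₁ j₂ a ha b hb
  rw [Finset.mem_inter] at ha hb
  exact hQT i j₁ j₂ a ha.2 b hb.2 ha.1 hb.1

end Blocks

/-! ### Validity as conditional independence of blocks -/

section Validity

open MeasureTheory ProbabilityTheory

variable {α : Fin n → Type} [∀ i, Countable (α i)] [∀ i, MeasurableSpace (α i)]
  [∀ i, DiscreteMeasurableSpace (α i)] {K : CMI n} {p : PMF (∀ i, α i)}

lemma prob_eq_measureReal (p : PMF (∀ i, α i)) (E : Set (∀ i, α i)) :
    prob p E = p.toMeasure.real E := by
  rw [prob, measureReal_def, p.toMeasure_apply_eq_toOuterMeasure_apply MeasurableSet.of_discrete]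

lemma isValid_iff : K.IsValid p ↔ ∀ y, p.toMeasure (agree K.cond y) ≠ 0 →
    BlocksIndep (fun j : K.parts => (j : Finset (Fin n))) (p.toMeasure[|agree K.cond y]) := by
  have hreal : ∀ y, 0 < prob p (agree K.cond y) ↔ p.toMeasure (agree K.cond y) ≠ 0 := by
    intro y
    rw [prob_eq_measureReal, measureReal_def, ENNReal.toReal_pos_iff, pos_iff_ne_zero]
    exact and_iff_left (measure_lt_top _ _)
  have hset : ∀ x : K.parts → ∀ i, α i,
      {ω | ∀ j : K.parts, ω ∈ agree (j : Finset (Fin n)) (x j)} =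
        ⋂ j : K.parts, agree (j : Finset (Fin n)) (x j) := fun x => by ext; simp
  unfold IsValid
  rw [forall_comm]
  refine forall_congr' fun y => ?_
  simp only [hset, hreal]
  by_cases hy : p.toMeasure (agree K.cond y) = 0
  · simp only [hy, ne_eq, not_true_eq_false, if_false, false_imp_iff, iff_true]
    intro x
    rw [prob_eq_measureReal, measureReal_def, measure_mono_null Set.inter_subset_right hy,
      ENNReal.toReal_zero]
  · have := cond_isProbabilityMeasure hy
    have hpos : prob p (agree K.cond y) ≠ 0 := ((hreal y).2 hy).ne'
    simp only [hy, ne_eq, not_false_eq_true, if_true, true_imp_iff]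
    rw [blocksIndep_iff]
    refine forall_congr' fun x => ?_
    have hcond : ∀ B : Set (∀ i, α i), ((p.toMeasure[|agree K.cond y]) B).toReal =
        prob p (B ∩ agree K.cond y) / prob p (agree K.cond y) := by
      intro B
      rw [cond_apply MeasurableSet.of_discrete, ENNReal.toReal_mul, ENNReal.toReal_inv,
        Set.inter_comm, prob_eq_measureReal, prob_eq_measureReal, measureReal_def,
        measureReal_def, mul_comm, div_eq_mul_inv]
    rw [← ENNReal.toReal_eq_toReal_iff' (measure_ne_top _ _)
      (ENNReal.prod_ne_top fun _ _ => measure_ne_top _ _), ENNReal.toReal_prod]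
    simp only [hcond]
    rw [div_eq_iff hpos]

lemma ae_cond_agree_const (A : Finset (Fin n)) (y : ∀ i, α i) (μ : Measure (∀ i, α i)) :
    ∀ i ∈ A, ∃ c, ∀ᵐ ω ∂μ[|agree A y], ω i = c := fun i hi =>
  ⟨y i, ae_cond_of_forall_mem MeasurableSet.of_discrete fun _ hω => hω i hi⟩

lemma IsValid.ae_const (h : K.IsValid p) {y : ∀ i, α i} (hy : p.toMeasure (agree K.cond y) ≠ 0)
    {a : Fin n} (ha : K.Sep a a) : ∃ c, ∀ᵐ ω ∂p.toMeasure[|agree K.cond y], ω a = c := by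
  have := cond_isProbabilityMeasure hy
  obtain ⟨j₁, j₂, hj, h₁, h₂⟩ := Separates.iff_exists_coe.1 ha.2.2
  exact (isValid_iff.1 h y hy).ae_const hj h₁ h₂

/-- If outside the almost surely constant coordinates no pair is separated, then `K` is valid. -/
lemma isValid_of_const {A : (∀ i, α i) → Finset (Fin n)}
    (hA : ∀ y, p.toMeasure (agree K.cond y) ≠ 0 →
      ∀ i ∈ A y, ∃ c, ∀ᵐ ω ∂p.toMeasure[|agree K.cond y], ω i = c)
    (hsep : ∀ y a b, a ∉ A y → b ∉ A y → ¬ K.Sep a b) : K.IsValid p := by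
  refine isValid_iff.2 fun y hy => ?_
  have := cond_isProbabilityMeasure hy
  refine BlocksIndep.of_sdiff (A := A y ∪ K.cond) ?_ (blocksIndep_of_subsingleton ?_)
  · intro i hi
    rcases Finset.mem_union.1 hi with hi | hi
    · exact hA y hy i hi
    · exact ae_cond_agree_const _ _ _ i hi
  · intro j₁ j₂ a ha b hb
    simp only [Finset.mem_sdiff, Finset.mem_union, not_or] at ha hb
    by_contra hj
    exact hsep y a b ha.2.1 hb.2.1 ⟨ha.2.2, hb.2.2,
      Separates.iff_exists_coe.2 ⟨j₁, j₂, hj, ha.1, hb.1⟩⟩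

end Validity

/-! ### Sufficiency of the sub-CMI relation -/

section Soundness

open MeasureTheory ProbabilityTheory

variable {α : Fin n → Type} [∀ i, Countable (α i)] [∀ i, MeasurableSpace (α i)]
  [∀ i, DiscreteMeasurableSpace (α i)] {K K' : CMI n} {p : PMF (∀ i, α i)}

/-- The combinatorial condition suffices: once the constant coordinates `C' ∪ 𝕀_K` are removed, the
blocks of `K'` are obtained by regrouping those of `K`, and the rest of `C'` is made of coordinates
of blocks of `K`, so that conditioning on it preserves independence. -/
theorem IsValid.of_isSubCMI (hK : K.IsValid p) (h : IsSubCMI K' K) : K'.IsValid p := by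
  rw [isSubCMI_iff] at h
  by_cases hN' : ∃ a b, K'.Sep a b
  swap
  · push Not at hN'
    exact isValid_of_const (A := fun _ => ∅) (by simp) fun _ a b _ _ => hN' a b
  obtain ⟨a₀, b₀, h₀⟩ := hN'
  have hCC : K.cond ⊆ K'.cond := (h a₀ b₀ h₀).1
  refine isValid_iff.2 fun y hy => ?_
  have hsplit : agree K'.cond y = agree K.cond y ∩ agree (K'.cond \ K.cond) y := by
    ext ω
    simp only [agree, Set.mem_inter_iff, Set.mem_ofPred_eq, Finset.mem_sdiff]
    refine ⟨fun h => ⟨fun i hi => h i (hCC hi), fun i hi => h i hi.1⟩, fun h i hi => ?_⟩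
    by_cases hiC : i ∈ K.cond
    · exact h.1 i hiC
    · exact h.2 i ⟨hi, hiC⟩
  have hyC : p.toMeasure (agree K.cond y) ≠ 0 := fun h0 =>
    hy (measure_mono_null (hsplit ▸ Set.inter_subset_left) h0)
  have := cond_isProbabilityMeasure hy
  have := cond_isProbabilityMeasure hyC
  have hq : p.toMeasure[|agree K'.cond y] =
      (p.toMeasure[|agree K.cond y])[|agree (K'.cond \ K.cond) y] := by
    rw [cond_cond_eq_cond_inter MeasurableSet.of_discrete MeasurableSet.of_discrete, ← hsplit]
  have hqy : (p.toMeasure[|agree K.cond y]) (agree (K'.cond \ K.cond) y) ≠ 0 := by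
    rw [hsplit] at hy
    exact (cond_pos_of_inter_ne_zero MeasurableSet.of_discrete hy).ne'
  refine BlocksIndep.of_sdiff (A := K'.cond ∪ K.pur.rep) ?_ ?_
  · intro i hi
    rcases Finset.mem_union.1 hi with hi | hi
    · exact ae_cond_agree_const _ _ _ i hi
    · obtain ⟨c, hc⟩ := hK.ae_const hyC (mem_rep_pur.1 hi)
      rw [hq]
      exact ⟨c, cond_absolutelyContinuous.ae_le hc⟩
  have hsep : ∀ {j₁ j₂ : K'.parts} {a b : Fin n}, j₁ ≠ j₂ →
      a ∈ (j₁ : Finset (Fin n)) \ (K'.cond ∪ K.pur.rep) →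
      b ∈ (j₂ : Finset (Fin n)) \ (K'.cond ∪ K.pur.rep) →
      ¬ K.Sep a a ∧ ¬ K.Sep b b ∧ K'.Sep a b := by
    intro j₁ j₂ a b hj ha hb
    simp only [Finset.mem_sdiff, Finset.mem_union, not_or, mem_rep_pur] at ha hb
    exact ⟨ha.2.2, hb.2.2, ha.2.1, hb.2.1,
      Separates.iff_exists_coe.2 ⟨j₁, j₂, hj, ha.1, hb.1⟩⟩
  by_cases hN : ∃ a b, ¬ K.Sep a a ∧ ¬ K.Sep b b ∧ K'.Sep a b
  swap
  · refine blocksIndep_of_subsingleton fun j₁ j₂ a ha b hb => ?_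
    by_contra hj
    exact hN ⟨a, b, hsep hj ha hb⟩
  obtain ⟨a₁, b₁, ha₁, hb₁, h₁⟩ := hN
  have hmem : ∀ {m c}, K.Sep m c → ∃ i : K.parts, m ∈ (i : Finset (Fin n)) := by
    intro m c hmc
    obtain ⟨i, -, -, hi, -⟩ := Separates.iff_exists_coe.1 hmc.2.2
    exact ⟨i, hi⟩
  rw [hq]
  by_cases hone : ∀ (j₁ j₂ : K'.parts),
      ∀ a ∈ (j₁ : Finset (Fin n)) \ (K'.cond ∪ K.pur.rep),
      ∀ b ∈ (j₂ : Finset (Fin n)) \ (K'.cond ∪ K.pur.rep), j₁ = j₂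
  · have := cond_isProbabilityMeasure hqy
    exact blocksIndep_of_subsingleton hone
  push Not at hone
  obtain ⟨k₁, k₂, a₂, ha₂, b₂, hb₂, hk⟩ := hone
  refine (isValid_iff.1 hK y hyC).cond_agree ?_ ?_ ?_ hqy
  · intro m hm
    rw [Finset.mem_sdiff] at hm
    by_cases hmm : K.Sep m m
    · exact hmem hmm
    · obtain ⟨c, -, hc⟩ := ((h a₁ b₁ h₁).2 ha₁ hb₁).2 m hm.1 hm.2 hmm
      exact hmem hc
  · intro j m hm
    -- One of two distinct members with a remaining index differs from `j`.
    obtain ⟨k, b, hjk, hb⟩ : ∃ (k : K'.parts) (b : Fin n), j ≠ k ∧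
        b ∈ (k : Finset (Fin n)) \ (K'.cond ∪ K.pur.rep) := by
      by_cases hjk : j = k₁
      · exact ⟨k₂, b₂, hjk ▸ hk, hb₂⟩
      · exact ⟨k₁, a₂, hjk, ha₂⟩
    obtain ⟨hm', hb', hmb⟩ := hsep hjk hm hb
    exact hmem ((h m b hmb).2 hm' hb').1
  · intro i j₁ j₂ a hai b hbi ha hb
    by_contra hj
    obtain ⟨ha', hb', hab⟩ := hsep hj ha hb
    obtain ⟨haC, hbC, hs⟩ := ((h a b hab).2 ha' hb').1
    obtain ⟨i₁, i₂, hi, hai₁, hbi₂⟩ := Separates.iff_exists_coe.1 hs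
    -- As `a` and `b` are not repeated in `K`, the member `i` is the only one containing either.
    have e₁ : i = i₁ := by
      by_contra hne
      exact ha' ⟨haC, haC, Separates.iff_exists_coe.2 ⟨i, i₁, hne, hai, hai₁⟩⟩
    have e₂ : i = i₂ := by
      by_contra hne
      exact hb' ⟨hbC, hbC, Separates.iff_exists_coe.2 ⟨i, i₂, hne, hbi, hbi₂⟩⟩
    exact hi (e₁.symm.trans e₂)

end Soundness

/-! ### Distributions violating an independency -/

section Counterexamples

open MeasureTheory ProbabilityTheory

/-- A valid CMI makes any two indices that it separates independent given its conditioning set. -/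
lemma IsValid.prob_mul_prob {α : Fin n → Type} [∀ i, Countable (α i)]
    {K : CMI n} {p : PMF (∀ i, α i)} (h : K.IsValid p) {a b : Fin n} (hab : K.Sep a b)
    (y : ∀ i, α i) (u : α a) (v : α b) :
    prob p (agree K.cond y ∩ {ω | ω a = u ∧ ω b = v}) * prob p (agree K.cond y) =
      prob p (agree K.cond y ∩ {ω | ω a = u}) * prob p (agree K.cond y ∩ {ω | ω b = v}) := by
  let _ : ∀ i, MeasurableSpace (α i) := fun _ => ⊤
  have : ∀ i, DiscreteMeasurableSpace (α i) := fun _ => ⟨fun _ => trivial⟩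
  simp only [prob_eq_measureReal]
  by_cases hy : p.toMeasure (agree K.cond y) = 0
  · have h0 : ∀ B, p.toMeasure.real (agree K.cond y ∩ B) = 0 := fun B => by
      rw [measureReal_def, measure_mono_null Set.inter_subset_left hy, ENNReal.toReal_zero]
    rw [h0, h0, zero_mul, zero_mul]
  obtain ⟨j₁, j₂, hj, ha, hb⟩ := Separates.iff_exists_coe.1 hab.2.2
  have hind : IndepFun (fun ω : ∀ i, α i => ω a) (fun ω => ω b)
      (p.toMeasure[|agree K.cond y]) :=
    (iIndepFun.indepFun (isValid_iff.1 h y hy) hj).comp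
      (φ := fun z : ∀ i : (j₁ : Finset (Fin n)), α i => z ⟨a, ha⟩)
      (ψ := fun z : ∀ i : (j₂ : Finset (Fin n)), α i => z ⟨b, hb⟩)
      Measurable.of_discrete Measurable.of_discrete
  have h1 := congrArg ENNReal.toReal <| hind.measure_inter_preimage_eq_mul {u} {v}
    MeasurableSet.of_discrete MeasurableSet.of_discrete
  simp only [cond_apply (MeasurableSet.of_discrete), ENNReal.toReal_mul, ENNReal.toReal_inv,
    ← measureReal_def] at h1
  have hpos : p.toMeasure.real (agree K.cond y) ≠ 0 := by
    rw [measureReal_def]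
    exact ENNReal.toReal_ne_zero.2 ⟨hy, measure_ne_top _ _⟩
  field_simp at h1
  rw [mul_comm]
  exact h1

variable {β : Type} [Fintype β] [Nonempty β]

/-- The joint distribution of the bits `X_1, …, X_n`, functions on a finite sample space `β` with
the uniform distribution. -/
noncomputable def bitLaw (X : β → Fin n → Bool) : PMF (∀ i, (fun _ : Fin n => Bool) i) :=
  (PMF.uniformOfFintype β).map X

lemma finiteEntropy_bitLaw (X : β → Fin n → Bool) : FiniteEntropy (bitLaw X) :=
  fun _ => Summable.of_finite

open Classical in
lemma prob_bitLaw (X : β → Fin n → Bool) (E : Set (Fin n → Bool)) :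
    prob (bitLaw X) E = (∑ b, if X b ∈ E then 1 else 0) / Fintype.card β := by
  rw [prob, bitLaw, PMF.toOuterMeasure_map_apply, PMF.toOuterMeasure_uniformOfFintype_apply,
    ENNReal.toReal_div, ENNReal.toReal_natCast, ENNReal.toReal_natCast, Finset.sum_boole,
    Fintype.card_subtype]
  rfl

lemma bitLaw_toMeasure_eq_zero_iff (X : β → Fin n → Bool) (E : Set (Fin n → Bool)) :
    (bitLaw X).toMeasure E = 0 ↔ ∀ b, X b ∉ E := by
  rw [PMF.toMeasure_apply_eq_zero_iff _ MeasurableSet.of_discrete, Set.disjoint_left]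
  simp [bitLaw]

/-- A bit that takes only one value on the conditioning event is conditionally constant. -/
lemma ae_cond_bitLaw_const {X : β → Fin n → Bool} {E : Set (Fin n → Bool)} {i : Fin n} {c : Bool}
    (h : ∀ b, X b ∈ E → X b i = c) : ∀ᵐ ω ∂(bitLaw X).toMeasure[|E], ω i = c := by
  rw [ae_iff, cond_apply MeasurableSet.of_discrete]
  refine mul_eq_zero.2 (Or.inr ?_)
  rw [bitLaw_toMeasure_eq_zero_iff]
  exact fun b hb => hb.2 (h b hb.1)

/-- One uniform bit shared by all the indices in `W`, the other indices being constant. -/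
def sharedBit (W : Finset (Fin n)) (s : Bool) (i : Fin n) : Bool := if i ∈ W then s else false

lemma isValid_sharedBit {K : CMI n} {W : Finset (Fin n)}
    (h : (∃ c ∈ W, c ∈ K.cond) ∨ ∀ a ∈ W, ∀ b ∈ W, ¬ K.Sep a b) :
    K.IsValid (bitLaw (sharedBit W)) := by
  rcases h with ⟨c, hcW, hcK⟩ | h
  · refine isValid_of_const (A := fun _ => Finset.univ) ?_ (by simp)
    intro y _ i _
    refine ⟨if i ∈ W then y c else false, ae_cond_bitLaw_const fun s hs => ?_⟩
    have : sharedBit W s c = y c := hs c hcK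
    rw [sharedBit, if_pos hcW] at this
    rw [sharedBit, this]
  · refine isValid_of_const (A := fun _ => Wᶜ) ?_ ?_
    · intro y _ i hi
      exact ⟨false, ae_cond_bitLaw_const fun s _ => if_neg (Finset.mem_compl.1 hi)⟩
    · intro _ a b ha hb
      rw [Finset.mem_compl, not_not] at ha hb
      exact h a ha b hb

lemma not_isValid_sharedBit {K : CMI n} {W : Finset (Fin n)} {a b : Fin n} (hab : K.Sep a b)
    (ha : a ∈ W) (hb : b ∈ W) (hW : ∀ c ∈ W, c ∉ K.cond) :
    ¬ K.IsValid (bitLaw (sharedBit W)) := by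
  intro h
  have h1 := h.prob_mul_prob hab (fun _ => false) true true
  have hE : ∀ s, sharedBit W s ∈ agree (α := fun _ => Bool) K.cond fun _ => false := by
    intro s i hi
    exact if_neg fun hiW => hW i hiW hi
  have hsa : ∀ s, sharedBit W s a = s := fun s => if_pos ha
  have hsb : ∀ s, sharedBit W s b = s := fun s => if_pos hb
  simp only [prob_bitLaw, Set.mem_inter_iff, hE, true_and, Set.mem_ofPred_eq, hsa, hsb] at h1
  norm_num at h1

/-- Two independent uniform bits at `a` and `b` and their sum modulo `2` at `c`, the other indices
being constant. -/
def parityBits (a b c : Fin n) (s : Bool × Bool) (i : Fin n) : Bool :=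
  if i = a then s.1 else if i = b then s.2 else if i = c then xor s.1 s.2 else false

lemma not_isValid_parityBits {K : CMI n} {a b c : Fin n} (hab : K.Sep a b) (hne : a ≠ b)
    (hc : c ∈ K.cond) : ¬ K.IsValid (bitLaw (parityBits a b c)) := by
  intro h
  have h1 := h.prob_mul_prob hab (fun _ => false) true true
  have hca : c ≠ a := fun h => hab.1 (h ▸ hc)
  have hcb : c ≠ b := fun h => hab.2.1 (h ▸ hc)
  have hE : ∀ s, parityBits a b c s ∈ agree (α := fun _ => Bool) K.cond (fun _ => false) ↔
      xor s.1 s.2 = false := by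
    intro s
    constructor
    · intro hs
      simpa [parityBits, hca, hcb] using hs c hc
    · intro hs i hi
      have hia : i ≠ a := fun h => hab.1 (h ▸ hi)
      have hib : i ≠ b := fun h => hab.2.1 (h ▸ hi)
      simp [parityBits, hia, hib, hs]
  have hsa : ∀ s, parityBits a b c s a = s.1 := fun s => if_pos rfl
  have hsb : ∀ s, parityBits a b c s b = s.2 := fun s => by simp [parityBits, hne.symm]
  simp only [prob_bitLaw, Set.mem_inter_iff, hE, Set.mem_ofPred_eq, hsa, hsb,
    Fintype.sum_prod_type, Fintype.sum_bool] at h1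
  norm_num at h1

lemma isValid_parityBits {K : CMI n} {a b c : Fin n} (ha : ¬ K.Sep a a) (hb : ¬ K.Sep b b)
    (hab : K.Sep a b) (hcC : c ∉ K.cond) (hc : ∀ m, ¬ K.Sep m m → ¬ K.Sep c m) :
    K.IsValid (bitLaw (parityBits a b c)) := by
  have hne : a ≠ b := fun h => hb (h ▸ hab)
  -- A member containing `c` would be separated from `a` or from `b`.
  have hcK : ∀ j : K.parts, c ∉ (j : Finset (Fin n)) := by
    intro j hj
    obtain ⟨i₁, i₂, hi, hi₁, hi₂⟩ := Separates.iff_exists_coe.1 hab.2.2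
    by_cases h : j = i₁
    · exact hc b hb ⟨hcC, hab.2.1, Separates.iff_exists_coe.2 ⟨j, i₂, h ▸ hi, hj, hi₂⟩⟩
    · exact hc a ha ⟨hcC, hab.1, Separates.iff_exists_coe.2 ⟨j, i₁, h, hj, hi₁⟩⟩
  have hsa : ∀ s, parityBits a b c s a = s.1 := fun s => if_pos rfl
  have hsb : ∀ s, parityBits a b c s b = s.2 := fun s => by simp [parityBits, hne.symm]
  refine isValid_iff.2 fun y hy => ?_
  have hcond : (bitLaw (parityBits a b c)).toMeasure[|agree K.cond y] =
      (bitLaw (parityBits a b c)).toMeasure := by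
    have hE : (bitLaw (parityBits a b c)).toMeasure (agree K.cond y)ᶜ = 0 := by
      rw [bitLaw_toMeasure_eq_zero_iff]
      rw [Ne, bitLaw_toMeasure_eq_zero_iff] at hy
      push Not at hy
      obtain ⟨t, ht⟩ := hy
      intro s
      rw [Set.mem_compl_iff, not_not]
      intro i hi
      have hia : i ≠ a := fun h => hab.1 (h ▸ hi)
      have hib : i ≠ b := fun h => hab.2.1 (h ▸ hi)
      have hic : i ≠ c := fun h => hcC (h ▸ hi)
      rw [← ht i hi]
      simp [parityBits, hia, hib, hic]
    have hE' : ∀ᵐ ω ∂(bitLaw (parityBits a b c)).toMeasure, ω ∈ agree K.cond y := hE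
    rw [ProbabilityTheory.cond, Measure.restrict_eq_self_of_ae_mem hE',
      (prob_compl_eq_zero_iff MeasurableSet.of_discrete).1 hE, inv_one, one_smul]
  rw [hcond]
  have hbits : BlocksIndep (α := fun _ => Bool) (fun t : Bool => if t then {a} else {b})
      (bitLaw (parityBits a b c)).toMeasure := by
    rw [blocksIndep_iff]
    intro x
    rw [← ENNReal.toReal_eq_toReal_iff' (measure_ne_top _ _)
      (ENNReal.prod_ne_top fun _ _ => measure_ne_top _ _), ENNReal.toReal_prod]
    simp only [← measureReal_def, ← prob_eq_measureReal, prob_bitLaw, Fintype.prod_bool,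
      Set.mem_iInter, Bool.forall_bool, agree, if_true, Bool.false_eq_true, if_false,
      Finset.mem_singleton, forall_eq, Set.mem_ofPred_eq, hsa, hsb,
      Fintype.sum_prod_type, Fintype.sum_bool]
    cases x true a <;> cases x false b <;> norm_num
  refine BlocksIndep.of_sdiff (A := {a, b, c}ᶜ) ?_ ?_
  · intro i hi
    refine ⟨false, ?_⟩
    rw [← hcond]
    refine ae_cond_bitLaw_const fun s _ => ?_
    simp only [Finset.mem_compl, Finset.mem_insert, Finset.mem_singleton, not_or] at hi
    simp [parityBits, hi]
  · -- Each member retains at most `a` or `b`, so its block is a regrouping of the two bits.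
    have huniv : agree (α := fun _ : Fin n => Bool) ∅ y = Set.univ := by simp [agree]
    have hreg : ∀ j : K.parts, ∀ m ∈ (j : Finset (Fin n)) \ {a, b, c}ᶜ, m = a ∨ m = b := by
      intro j m hm
      simp only [Finset.mem_sdiff, Finset.mem_compl, Finset.mem_insert, Finset.mem_singleton,
        not_not] at hm
      rcases hm.2 with h | h | h
      · exact Or.inl h
      · exact Or.inr h
      · exact absurd (h ▸ hm.1) (hcK j)
    have := hbits.cond_agree (D := ∅) (y := y)
      (T := fun j : K.parts => (j : Finset (Fin n)) \ {a, b, c}ᶜ) (by simp) ?_ ?_ ?_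
    · rwa [huniv, cond_univ] at this
    · intro j m hm
      rcases hreg j m hm with rfl | rfl
      · exact ⟨true, by simp⟩
      · exact ⟨false, by simp⟩
    · intro t j₁ j₂ m₁ hm₁ m₂ hm₂ h₁ h₂
      have e : m₁ = m₂ := by
        cases t <;> simp at hm₁ hm₂ <;> rw [hm₁, hm₂]
      subst e
      by_contra hj
      have hs : Separates K.parts m₁ m₁ := Separates.iff_exists_coe.2
        ⟨j₁, j₂, hj, (Finset.mem_sdiff.1 h₁).1, (Finset.mem_sdiff.1 h₂).1⟩
      rcases hreg j₁ m₁ h₁ with rfl | rfl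
      · exact ha ⟨hab.1, hab.1, hs⟩
      · exact hb ⟨hab.2.1, hab.2.1, hs⟩
    · rw [huniv, measure_univ]
      exact one_ne_zero

end Counterexamples

variable {K K' : CMI n}

/-- The combinatorial condition is necessary: its failure is witnessed by a shared bit or by a
parity. -/
theorem Implies.isSubCMI (h : Implies K K') : IsSubCMI K' K := by
  have himp : ∀ {β : Type} [Fintype β] [Nonempty β] (X : β → Fin n → Bool),
      K.IsValid (bitLaw X) → K'.IsValid (bitLaw X) := fun X =>
    h (fun _ => Bool) (bitLaw X) (finiteEntropy_bitLaw X)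
  rw [isSubCMI_iff]
  intro a b hab
  have hC : K.cond ⊆ K'.cond := by
    intro c hcK
    by_contra hcK'
    refine not_isValid_sharedBit (W := {c, a, b}) hab (by simp) (by simp) ?_
      (himp _ (isValid_sharedBit (Or.inl ⟨c, by simp, hcK⟩)))
    intro i hi
    simp only [Finset.mem_insert, Finset.mem_singleton] at hi
    rcases hi with rfl | rfl | rfl
    exacts [hcK', hab.1, hab.2.1]
  refine ⟨hC, fun ha hb => ?_⟩
  have habK : K.Sep a b := by
    by_contra habK
    refine not_isValid_sharedBit (W := {a, b}) hab (by simp) (by simp) ?_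
      (himp _ (isValid_sharedBit (Or.inr ?_)))
    · intro i hi
      simp only [Finset.mem_insert, Finset.mem_singleton] at hi
      rcases hi with rfl | rfl
      exacts [hab.1, hab.2.1]
    · intro i hi j hj
      simp only [Finset.mem_insert, Finset.mem_singleton] at hi hj
      rcases hi with rfl | rfl <;> rcases hj with rfl | rfl
      exacts [ha, habK, fun h => habK h.symm, hb]
  refine ⟨habK, fun m hm hmC _ => ?_⟩
  by_contra! hmK
  exact not_isValid_parityBits hab (fun e => hb (e ▸ habK)) hm
    (himp _ (isValid_parityBits ha hb habK hmC hmK))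

end CMI

theorem mainTheorem1 {n : ℕ} (K K' : CMI n) :
    (CMI.Implies K K' ↔ CMI.IsSubCMI K' K) ∧
      (CMI.ImpliesDiscrete K K' ↔ CMI.IsSubCMI K' K) := by
  have hsound : CMI.IsSubCMI K' K → CMI.ImpliesDiscrete K K' := by
    intro h α _ p hK
    let _ : ∀ i, MeasurableSpace (α i) := fun _ => ⊤
    have : ∀ i, DiscreteMeasurableSpace (α i) := fun _ => ⟨fun _ => trivial⟩
    exact hK.of_isSubCMI h
  have hfin : CMI.ImpliesDiscrete K K' → CMI.Implies K K' := fun h α _ p _ => h α p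
  exact ⟨⟨fun h => h.isSubCMI, fun h => hfin (hsound h)⟩,
    ⟨fun h => (hfin h).isSubCMI, hsound⟩⟩
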